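/- For each $n \in \mathbb{N}$ let $G^{(n)}$ be a finite abelian group, with $|G^{(n)}| \to \infty$, and let $\{Y_a^{(n)} \mid a \in G^{(n)}\}$ be independent complex random variables such that \[ \mathbb{E} Y_a^{(n)} = 0, \qquad \mathbb{E} \bigl|Y_a^{(n)}\bigr|^2 = 1, \qquad \mathbb{E} \bigl(Y_a^{(n)}\bigr)^2 = 0 \] for every $a \in G^{(n)}$, and such that the following Lindeberg condition holds: \[ \forall \varepsilon > 0 : \quad \lim_{n \to \infty} \frac{1}{|G^{(n)}|} \sum_{a \in G^{(n)}} \mathbb{E} \Bigl( \bigl|Y_a^{(n)}\bigr|^2 \mathbf{1}_{\{|Y_a^{(n)}| \ge \varepsilon \sqrt{|G^{(n)}|}\}} \Bigr) = 0. \] Let $\mu^{(n)}$ be the empirical spectral measure of the random $G^{(n)}$-circulant matrix \[ M^{(n)} = \Bigl[ |G^{(n)}|^{-1/2}\, Y^{(n)}_{ab^{-1}} \Bigr]_{a,b \in G^{(n)}}, \] that is, $\mu^{(n)} = \frac{1}{|G^{(n)}|} \sum_\lambda \delta_\lambda$, where $\lambda$ runs over the eigenvalues of $M^{(n)}$ counted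 with multiplicity. Then, without any assumption on the proportion $|\{a \in G^{(n)} \mid a^2 = 1\}|/|G^{(n)}|$, $\mu^{(n)}$ converges weakly, in mean and in probability, to the standard complex Gaussian measure $\gamma_{\mathbb{C}}$ (the law of $X + iX'$ with $X, X'$ independent real Gaussians of mean $0$ and variance $1/2$). Explicitly, for every bounded continuous $f : \mathbb{C} \to \mathbb{R}$, $\mathbb{E} \int f \, d\mu^{(n)} \to \int f \, d\gamma_{\mathbb{C}}$, and $\int f \, d\mu^{(n)} \to \int f \, d\gamma_{\mathbb{C}}$ in probability. -/

import Mathlib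

open MeasureTheory ProbabilityTheory Filter Topology
open scoped ENNReal NNReal BoundedContinuousFunction

/-- The `G`-circulant matrix `[f (a b⁻¹)]` with rows and columns indexed by `a, b ∈ G`. -/
def gCirculant {G : Type*} [Group G] (f : G → ℂ) : Matrix G G ℂ :=
  Matrix.of fun a b => f (a * b⁻¹)

/-- The normalized `G`-circulant matrix `[|G|^{-1/2} y (a b⁻¹)]`. -/
noncomputable def normalizedGCirculant {G : Type*} [Group G] [Fintype G] (y : G → ℂ) :
    Matrix G G ℂ :=
  gCirculant fun a => ((1 / √(Fintype.card G : ℝ) : ℝ) : ℂ) * y a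

/-- The empirical spectral distribution of a square complex matrix: the normalized sum of the
point masses at the eigenvalues, counted with (algebraic) multiplicity, that is, at the roots of
the characteristic polynomial. -/
noncomputable def empiricalSpectralMeasure {ι : Type*} [Fintype ι] [DecidableEq ι]
    (A : Matrix ι ι ℂ) : Measure ℂ :=
  (Fintype.card ι : ℝ≥0∞)⁻¹ • (A.charpoly.roots.map fun z => Measure.dirac z).sum

/-- The standard complex Gaussian distribution: the law of `X + i Y` with `X`, `Y` independent
real Gaussians of mean `0` and variance `1/2`, so that the second absolute moment is `1`. -/
noncomputable def stdComplexGaussian : Measure ℂ :=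
  ((gaussianReal 0 (1 / 2)).prod (gaussianReal 0 (1 / 2))).map
    fun p : ℝ × ℝ => (⟨p.1, p.2⟩ : ℂ)

/-- The Lindeberg condition for a family of complex random variables indexed by finite sets
`G n`, with `Y n a` defined on the probability space `(Ω n, P n)`. -/
def LindebergCondition {G : ℕ → Type*} [∀ n, Fintype (G n)] {Ω : ℕ → Type*}
    [∀ n, MeasurableSpace (Ω n)] (P : ∀ n, Measure (Ω n)) (Y : ∀ n, G n → Ω n → ℂ) : Prop :=
  ∀ ε : ℝ, 0 < ε →
    Tendsto (fun n => (1 / (Fintype.card (G n) : ℝ)) *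
        ∑ a : G n, ∫ ω in {ω | ε * √(Fintype.card (G n) : ℝ) ≤ ‖Y n a ω‖}, ‖Y n a ω‖ ^ 2 ∂(P n))
      atTop (𝓝 0)

/-- Weak convergence in mean of random measures `μ n` on `ℂ` (with `μ n` defined on `(Ω n, P n)`)
to `ν`: the mean measures, given by `(𝔼 μ) f = 𝔼 (μ f)`, converge weakly to `ν`. That the
expectations exist is part of the assertion. -/
def ConvergesWeaklyInMean {Ω : ℕ → Type*} [∀ n, MeasurableSpace (Ω n)]
    (P : ∀ n, Measure (Ω n)) (μ : ∀ n, Ω n → Measure ℂ) (ν : Measure ℂ) : Prop :=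
  ∀ f : ℂ →ᵇ ℝ,
    (∀ n, Integrable (fun ω => ∫ z, f z ∂(μ n ω)) (P n)) ∧
    Tendsto (fun n => ∫ ω, ∫ z, f z ∂(μ n ω) ∂(P n)) atTop (𝓝 (∫ z, f z ∂ν))

/-- Weak convergence in probability of random measures `μ n` on `ℂ` (with `μ n` defined on
`(Ω n, P n)`) to `ν`: for every bounded continuous `f`, the random variables `μ n f` converge to
`ν f` in probability. -/
def ConvergesWeaklyInProbability {Ω : ℕ → Type*} [∀ n, MeasurableSpace (Ω n)]
    (P : ∀ n, Measure (Ω n)) (μ : ∀ n, Ω n → Measure ℂ) (ν : Measure ℂ) : Prop :=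
  ∀ f : ℂ →ᵇ ℝ, ∀ ε : ℝ, 0 < ε →
    Tendsto (fun n => P n {ω | ε ≤ |∫ z, f z ∂(μ n ω) - ∫ z, f z ∂ν|}) atTop (𝓝 0)

/-! The characters of `G` diagonalize the circulant matrix, with eigenvalues `λ_χ = N^{-1/2} ∑ₐ conj
(χ a) Yₐ`, where `N = |G|`. A real linear functional of a pair `(λ_χ, λ_ψ)` has the form `Re ∑ₐ cₐ
Yₐ`. Since `𝔼 Yₐ² = 0`, its variance is `∑ₐ |cₐ|² / 2`, whatever the arguments of the `cₐ`. Hence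
only the orthogonality of `χ` and `ψ` matters, never that of `χ` and `conj ψ`: real characters, and
with them the elements of order two, play no special role.

For `χ ≠ ψ` a quantitative Lindeberg estimate (`norm_integral_exp_sum_re_sub_exp_le`) compares the
characteristic function of the pair with that of two independent complex Gaussians, uniformly in the
pair. The `N` diagonal pairs among the `N²` cost `O(1/N)`, so the mean of `μ ⊗ μ` converges weakly
to `γ ⊗ γ` (`tendsto_integral_eigenvaluePairMeasure`).

Testing against `f ⊗ 1` gives convergence in mean. Testing against `f ⊗ f` gives the second moment
of `∫ f dμ`, and Chebyshev's inequality then gives convergence in probability. -/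

theorem norm_prod_sub_prod_le_sum {ι : Type*} (s : Finset ι) (z w : ι → ℂ)
    (hz : ∀ i ∈ s, ‖z i‖ ≤ 1) (hw : ∀ i ∈ s, ‖w i‖ ≤ 1) :
    ‖∏ i ∈ s, z i - ∏ i ∈ s, w i‖ ≤ ∑ i ∈ s, ‖z i - w i‖ := by
  classical
  induction s using Finset.induction_on with
  | empty => simp
  | insert a s ha ih =>
    simp only [Finset.mem_insert, forall_eq_or_imp] at hz hw
    rw [Finset.prod_insert ha, Finset.prod_insert ha, Finset.sum_insert ha]
    have hprod : ‖∏ i ∈ s, w i‖ ≤ 1 := by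
      rw [norm_prod]
      exact Finset.prod_le_one (fun i _ => norm_nonneg _) hw.2
    -- Telescoping: one factor is exchanged at a time, the others having norm at most 1.
    calc ‖z a * ∏ i ∈ s, z i - w a * ∏ i ∈ s, w i‖
        = ‖(z a - w a) * ∏ i ∈ s, w i + z a * (∏ i ∈ s, z i - ∏ i ∈ s, w i)‖ := by ring_nf
      _ ≤ ‖z a - w a‖ * ‖∏ i ∈ s, w i‖ + ‖z a‖ * ‖∏ i ∈ s, z i - ∏ i ∈ s, w i‖ := by
          refine (norm_add_le _ _).trans ?_
          rw [norm_mul, norm_mul]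
      _ ≤ ‖z a - w a‖ * 1 + 1 * ∑ i ∈ s, ‖z i - w i‖ := by
          gcongr
          · exact hz.1
          · exact ih hz.2 hw.2
      _ = _ := by ring

/-- The second order Taylor remainder of `x ↦ exp (i x)`, in the form used in the Lindeberg
method. -/
theorem norm_exp_mul_I_sub_taylor_two_le {x δ : ℝ} (hδ : 0 < δ) (hδ1 : δ ≤ 1) :
    ‖Complex.exp (x * Complex.I) - (1 + x * Complex.I - (x : ℂ) ^ 2 / 2)‖
      ≤ 3 * δ * x ^ 2 + 4 * ({x : ℝ | δ ≤ |x|}.indicator (fun x => x ^ 2) x) := by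
  by_cases hx : δ ≤ |x|
  · rw [Set.indicator_of_mem (by exact hx)]
    -- For `|x| ≤ 1` this remainder is at most `x²`; for `|x| > 1` it is at most `2 + |x| ≤ 3x²`.
    -- Adding `x²/2` stays below the `4x²` of the claim.
    have h1 : ‖Complex.exp (x * Complex.I) - (1 + x * Complex.I)‖ ≤ 3 * x ^ 2 := by
      by_cases hx1 : |x| ≤ 1
      · have := Complex.norm_exp_sub_one_sub_id_le (x := x * Complex.I) (by simpa using hx1)
        simp only [norm_mul, Complex.norm_I, Complex.norm_real, Real.norm_eq_abs, mul_one,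
          sq_abs] at this
        rw [← sub_sub]
        nlinarith [sq_nonneg x]
      · have h2 : ‖Complex.exp (x * Complex.I) - (1 + x * Complex.I)‖ ≤ 1 + (1 + |x|) := by
          refine (norm_sub_le _ _).trans ?_
          rw [Complex.norm_exp_ofReal_mul_I]
          gcongr
          refine (norm_add_le _ _).trans ?_
          simp
        have := sq_abs x
        nlinarith
    have h3 : ‖(x : ℂ) ^ 2 / 2‖ = x ^ 2 / 2 := by simp
    have h4 := norm_add_le (Complex.exp (x * Complex.I) - (1 + x * Complex.I)) ((x : ℂ) ^ 2 / 2)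
    rw [h3] at h4
    have h5 : Complex.exp (x * Complex.I) - (1 + x * Complex.I - (x : ℂ) ^ 2 / 2) =
      Complex.exp (x * Complex.I) - (1 + x * Complex.I) + (x : ℂ) ^ 2 / 2 := by ring
    rw [h5]
    have : 0 ≤ δ * x ^ 2 := by positivity
    nlinarith [sq_nonneg x]
  · rw [Set.indicator_of_notMem (by exact hx)]
    push Not at hx
    have h := Complex.norm_exp_sub_sum_le_norm_mul_exp (x * Complex.I) 3
    have h1 : ∑ m ∈ Finset.range 3, ((x : ℂ) * Complex.I) ^ m / (m.factorial : ℂ) =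
        1 + x * Complex.I - (x : ℂ) ^ 2 / 2 := by
      simp [Finset.sum_range_succ, Nat.factorial, mul_pow]
      ring
    rw [h1] at h
    simp only [norm_mul, Complex.norm_I, Complex.norm_real, Real.norm_eq_abs, mul_one] at h
    refine h.trans ?_
    have h2 : Real.exp |x| ≤ 3 :=
      (Real.exp_le_exp.2 (hx.le.trans hδ1)).trans (by linarith [Real.exp_one_lt_d9])
    have h3 : |x| ^ 3 = |x| * x ^ 2 := by rw [← sq_abs x]; ring
    rw [h3]
    calc |x| * x ^ 2 * Real.exp |x| ≤ δ * x ^ 2 * 3 := by gcongr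
      _ = _ := by ring

theorem abs_exp_neg_sub_one_add_le {x : ℝ} (hx : 0 ≤ x) : |Real.exp (-x) - (1 - x)| ≤ x ^ 2 := by
  rcases le_total x 1 with h | h
  · have := Real.abs_exp_sub_one_sub_id_le (x := -x) (by rwa [abs_neg, abs_of_nonneg hx])
    rw [neg_sq] at this
    convert! this using 2
    ring
  · have h1 : Real.exp (-x) ≤ 1 := Real.exp_le_one_iff.2 (by linarith)
    have h2 := Real.add_one_le_exp (-x)
    rw [abs_le]
    constructor <;> nlinarith

/-! ### Quantitative Lindeberg estimate for characteristic functions -/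

section Lindeberg

variable {Ω : Type*} [MeasurableSpace Ω] {P : Measure Ω}

/-- Second moment of the real part of `c Z` for a centred circularly symmetric `Z`. -/
theorem integral_re_mul_sq {Z : Ω → ℂ} (hZ : Measurable Z)
    (hvar : ∫ ω, ‖Z ω‖ ^ 2 ∂P = 1) (hsq : ∫ ω, Z ω ^ 2 ∂P = 0) (c : ℂ) :
    ∫ ω, (c * Z ω).re ^ 2 ∂P = ‖c‖ ^ 2 / 2 := by
  -- The integral of a non-integrable function is 0 by convention, so the value 1 forces
  -- integrability.
  have hint : Integrable (fun ω => ‖Z ω‖ ^ 2) P := by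
    by_contra h
    rw [integral_undef h] at hvar
    exact zero_ne_one hvar
  have hint2 : Integrable (fun ω => Z ω ^ 2) P :=
    hint.mono' (by fun_prop) (by simp)
  -- `(Re w)² = (|w|² + Re w²) / 2`; the second term has mean zero by circular symmetry.
  have h (ω : Ω) : (c * Z ω).re ^ 2 =
      ‖c‖ ^ 2 / 2 * ‖Z ω‖ ^ 2 + RCLike.re (c ^ 2 / 2 * Z ω ^ 2) := by
    rw [← Complex.normSq_eq_norm_sq, ← Complex.normSq_eq_norm_sq, Complex.normSq_apply,
      Complex.normSq_apply]
    have : c ^ 2 / 2 * Z ω ^ 2 = (((1 / 2 : ℝ) : ℂ)) * (c * Z ω * (c * Z ω)) := by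
      push_cast; ring
    rw [this, RCLike.re_to_complex, Complex.re_ofReal_mul]
    simp only [Complex.mul_re, Complex.mul_im]
    ring
  simp_rw [h]
  rw [integral_add (hint.const_mul _) (hint2.const_mul _).re, integral_const_mul, hvar,
    integral_re (hint2.const_mul _), integral_const_mul, hsq]
  simp

/-- The second order Taylor polynomial has mean `1 - |c|²/4`. Its remainder gives the first two
terms of the bound, the truncation passing from `|Re (c Z)|` to `K‖Z‖`; replacing `1 - |c|²/4` by
the exponential costs at most `K⁴`. -/
theorem norm_integral_exp_re_mul_sub_exp_le [IsProbabilityMeasure P] {Z : Ω → ℂ} (hZ : Measurable Z)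
    (hmean : ∫ ω, Z ω ∂P = 0)
    (hvar : ∫ ω, ‖Z ω‖ ^ 2 ∂P = 1) (hsq : ∫ ω, Z ω ^ 2 ∂P = 0) {c : ℂ} {K δ : ℝ}
    (hc : ‖c‖ ≤ K) (hδ : 0 < δ) (hδ1 : δ ≤ 1) :
    ‖∫ ω, Complex.exp ((c * Z ω).re * Complex.I) ∂P - (Real.exp (-(‖c‖ ^ 2 / 4)) : ℝ)‖ ≤
      3 * δ * K ^ 2 + 4 * K ^ 2 * ∫ ω in {ω | δ ≤ K * ‖Z ω‖}, ‖Z ω‖ ^ 2 ∂P + K ^ 4 := by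
  have hint : Integrable (fun ω => ‖Z ω‖ ^ 2) P := by
    by_contra h
    rw [integral_undef h] at hvar
    exact zero_ne_one hvar
  have hZint : Integrable Z P := by
    refine (((memLp_two_iff_integrable_sq_norm hZ.aestronglyMeasurable).2 hint).integrable
      one_le_two)
  have hK : 0 ≤ K := (norm_nonneg c).trans hc
  set ξ : Ω → ℝ := fun ω => (c * Z ω).re with hξ
  have hξm : Measurable ξ := by fun_prop
  have hξ1 : Integrable ξ P := (hZint.const_mul c).re
  have hξle (ω : Ω) : |ξ ω| ≤ K * ‖Z ω‖ :=
    (Complex.abs_re_le_norm _).trans (by rw [norm_mul]; gcongr)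
  have hξsq (ω : Ω) : ξ ω ^ 2 ≤ K ^ 2 * ‖Z ω‖ ^ 2 := by
    rw [← sq_abs, ← mul_pow]
    exact pow_le_pow_left₀ (abs_nonneg _) (hξle ω) 2
  have hξ2 : Integrable (fun ω => ξ ω ^ 2) P :=
    (hint.const_mul (K ^ 2)).mono' (by fun_prop) (by
      filter_upwards with ω
      rw [Real.norm_eq_abs, abs_of_nonneg (sq_nonneg _)]
      exact hξsq ω)
  have hexp : Integrable (fun ω => Complex.exp (ξ ω * Complex.I)) P :=
    Integrable.of_bound (C := 1) (by fun_prop) (by simp [Complex.norm_exp_ofReal_mul_I])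
  have hξ1c : Integrable (fun ω => (ξ ω : ℂ) * Complex.I) P := hξ1.ofReal.mul_const _
  have hξ2c : Integrable (fun ω => (ξ ω : ℂ) ^ 2 / 2) P := by
    have := (hξ2.ofReal (𝕜 := ℂ)).div_const 2
    simpa using this
  have hlin : Integrable (fun ω => 1 + (ξ ω : ℂ) * Complex.I) P := (integrable_const _).add hξ1c
  have hquad : Integrable (fun ω => 1 + (ξ ω : ℂ) * Complex.I - (ξ ω : ℂ) ^ 2 / 2) P :=
    hlin.sub hξ2c
  have hpoly : ∫ ω, (1 + ξ ω * Complex.I - (ξ ω : ℂ) ^ 2 / 2) ∂P =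
      ((1 - ‖c‖ ^ 2 / 4 : ℝ) : ℂ) := by
    rw [integral_sub hlin hξ2c,
      integral_add (integrable_const _) hξ1c, integral_mul_const, integral_div]
    have h1 : ∫ ω, (ξ ω : ℂ) ∂P = 0 := by
      rw [integral_complex_ofReal]
      have := integral_re (hZint.const_mul c)
      simp only [RCLike.re_to_complex] at this
      rw [this, integral_const_mul, hmean]
      simp
    have h2 : ∫ ω, (ξ ω : ℂ) ^ 2 ∂P = ((‖c‖ ^ 2 / 2 : ℝ) : ℂ) := by
      rw [← integral_re_mul_sq hZ hvar hsq c, ← integral_complex_ofReal]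
      simp [hξ]
    rw [h1, h2]
    simp
    ring
  have hrem : ‖∫ ω, (Complex.exp (ξ ω * Complex.I) -
      (1 + ξ ω * Complex.I - (ξ ω : ℂ) ^ 2 / 2)) ∂P‖ ≤
      3 * δ * K ^ 2 + 4 * K ^ 2 * ∫ ω in {ω | δ ≤ K * ‖Z ω‖}, ‖Z ω‖ ^ 2 ∂P := by
    have hms : MeasurableSet {ω | δ ≤ K * ‖Z ω‖} :=
      measurableSet_le measurable_const (by fun_prop)
    refine (norm_integral_le_of_norm_le (g := fun ω => 3 * δ * K ^ 2 * ‖Z ω‖ ^ 2 +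
      4 * K ^ 2 * {ω | δ ≤ K * ‖Z ω‖}.indicator (fun ω => ‖Z ω‖ ^ 2) ω) ?_ ?_).trans_eq ?_
    · exact (hint.const_mul _).add ((hint.indicator hms).const_mul _)
    · filter_upwards with ω
      refine (norm_exp_mul_I_sub_taylor_two_le hδ hδ1).trans ?_
      have h1 : {x : ℝ | δ ≤ |x|}.indicator (fun x => x ^ 2) (ξ ω) ≤
          K ^ 2 * {ω | δ ≤ K * ‖Z ω‖}.indicator (fun ω => ‖Z ω‖ ^ 2) ω := by
        by_cases h : δ ≤ |ξ ω|
        · rw [Set.indicator_of_mem (by exact h), Set.indicator_of_mem (by exact h.trans (hξle ω))]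
          exact hξsq ω
        · rw [Set.indicator_of_notMem (by exact h)]
          exact mul_nonneg (sq_nonneg _) (Set.indicator_nonneg (fun _ _ => by positivity) _)
      have h2 := mul_le_mul_of_nonneg_left (hξsq ω) hδ.le
      linarith
    · rw [integral_add (hint.const_mul _) ((hint.indicator hms).const_mul _), integral_const_mul,
        integral_const_mul, hvar, integral_indicator hms, mul_one]
  rw [integral_sub hexp hquad, hpoly] at hrem
  have hlast : ‖((1 - ‖c‖ ^ 2 / 4 : ℝ) : ℂ) - (Real.exp (-(‖c‖ ^ 2 / 4)) : ℝ)‖ ≤ K ^ 4 := by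
    rw [← Complex.ofReal_sub, Complex.norm_real, Real.norm_eq_abs, abs_sub_comm]
    refine (abs_exp_neg_sub_one_add_le (by positivity)).trans ?_
    have h4 : ‖c‖ ^ 4 ≤ K ^ 4 := by gcongr
    have : 0 ≤ ‖c‖ ^ 4 := by positivity
    nlinarith
  exact (norm_sub_le_norm_sub_add_norm_sub _ _ _).trans (add_le_add hrem hlast)

/-- A quantitative Lindeberg theorem for linear combinations of independent centred circularly
symmetric variables. -/
theorem norm_integral_exp_sum_re_sub_exp_le [IsProbabilityMeasure P] {ι : Type*} [Fintype ι] {Y : ι → Ω → ℂ}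
    (hmeas : ∀ a, Measurable (Y a)) (hindep : iIndepFun Y P)
    (hmean : ∀ a, ∫ ω, Y a ω ∂P = 0) (hvar : ∀ a, ∫ ω, ‖Y a ω‖ ^ 2 ∂P = 1)
    (hsq : ∀ a, ∫ ω, (Y a ω) ^ 2 ∂P = 0) {c : ι → ℂ} {K δ : ℝ}
    (hc : ∀ a, ‖c a‖ ≤ K) (hδ : 0 < δ) (hδ1 : δ ≤ 1) :
    ‖∫ ω, Complex.exp ((∑ a, c a * Y a ω).re * Complex.I) ∂P -
        (Real.exp (-(∑ a, ‖c a‖ ^ 2) / 4) : ℝ)‖ ≤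
      Fintype.card ι * (3 * δ * K ^ 2 + K ^ 4) +
        4 * K ^ 2 * ∑ a, ∫ ω in {ω | δ ≤ K * ‖Y a ω‖}, ‖Y a ω‖ ^ 2 ∂P := by
  have h1 : ∫ ω, Complex.exp ((∑ a, c a * Y a ω).re * Complex.I) ∂P =
      ∏ a, ∫ ω, Complex.exp ((c a * Y a ω).re * Complex.I) ∂P := by
    rw [← hindep.integral_fun_prod_comp (f := fun a z => Complex.exp ((c a * z).re * Complex.I))
      (fun a => (hmeas a).aemeasurable)
      (fun a => by fun_prop)]
    simp_rw [← Complex.exp_sum, ← Finset.sum_mul, Complex.re_sum, Complex.ofReal_sum]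
  have h2 : ((Real.exp (-(∑ a, ‖c a‖ ^ 2) / 4) : ℝ) : ℂ) =
      ∏ a, ((Real.exp (-(‖c a‖ ^ 2 / 4)) : ℝ) : ℂ) := by
    rw [← Complex.ofReal_prod, ← Real.exp_sum, Finset.sum_neg_distrib, ← Finset.sum_div, neg_div]
  rw [h1, h2]
  refine (norm_prod_sub_prod_le_sum _ _ _ (fun a _ => ?_) (fun a _ => ?_)).trans
    ((Finset.sum_le_sum fun a _ => norm_integral_exp_re_mul_sub_exp_le (hmeas a) (hmean a) (hvar a)
      (hsq a) (hc a) hδ hδ1).trans_eq ?_)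
  · exact (norm_integral_le_of_norm_le_const (C := 1) (by
      simp only [Complex.norm_exp_ofReal_mul_I]; simp)).trans (by simp)
  · rw [Complex.norm_real, Real.norm_eq_abs, Real.abs_exp, Real.exp_le_one_iff, neg_nonpos]
    positivity
  · rw [Finset.sum_add_distrib, Finset.sum_add_distrib, Finset.mul_sum]
    simp only [Finset.sum_const, Finset.card_univ, nsmul_eq_mul]
    ring

end Lindeberg

/-! ### Diagonalization by characters -/

section Circulant

variable {G : Type*} [CommGroup G] [Fintype G]

/-- The eigenvalue of the normalized `G`-circulant matrix of `y` at the character `χ`. -/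
noncomputable def circulantEigenvalue (y : G → ℂ) (χ : AddChar (Additive G) ℂ) : ℂ :=
  ∑ a : G, ((1 / √(Fintype.card G : ℝ) : ℝ) : ℂ) * star (χ (Additive.ofMul a)) * y a

theorem normalizedGCirculant_mulVec (y : G → ℂ) (χ : AddChar (Additive G) ℂ) :
    (normalizedGCirculant y).mulVec (fun a => χ (Additive.ofMul a)) =
      circulantEigenvalue y χ • fun a => χ (Additive.ofMul a) := by
  ext a
  simp only [Matrix.mulVec, dotProduct, normalizedGCirculant, gCirculant, Matrix.of_apply,
    circulantEigenvalue, Pi.smul_apply, smul_eq_mul, Finset.sum_mul]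
  refine Fintype.sum_equiv ((Equiv.inv G).trans (Equiv.mulLeft a)) _ _ fun b => ?_
  have h : χ (Additive.ofMul b) =
      star (χ (Additive.ofMul (a * b⁻¹))) * χ (Additive.ofMul a) := by
    rw [Complex.star_def, ← AddChar.map_neg_eq_conj, ← AddChar.map_add_eq_mul, ← ofMul_inv,
      ← ofMul_mul]
    congr 2
    simp
  simp only [Equiv.trans_apply, Equiv.inv_apply, Equiv.coe_mulLeft]
  rw [h]
  ring

/-- The characters form a basis of `G → ℂ` consisting of eigenvectors, so each contributes exactly
one root, multiplicities included. -/
theorem charpoly_normalizedGCirculant [DecidableEq G] (y : G → ℂ) :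
    (normalizedGCirculant y).charpoly =
      ∏ χ : AddChar (Additive G) ℂ, (Polynomial.X - Polynomial.C (circulantEigenvalue y χ)) := by
  classical
  let b : Module.Basis (AddChar (Additive G) ℂ) ℂ (G → ℂ) := AddChar.complexBasis (Additive G)
  have hb (χ : AddChar (Additive G) ℂ) : b χ = fun a => χ (Additive.ofMul a) :=
    AddChar.complexBasis_apply χ
  have hdiag : LinearMap.toMatrix b b (Matrix.toLin' (normalizedGCirculant y)) =
      Matrix.diagonal (circulantEigenvalue y) := by
    ext χ ψ
    rw [LinearMap.toMatrix_apply, Matrix.toLin'_apply, hb, normalizedGCirculant_mulVec, ← hb,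
      map_smul, b.repr_self, Finsupp.smul_apply, Finsupp.single_apply, Matrix.diagonal_apply]
    by_cases h : χ = ψ
    · simp [h]
    · simp [h, Ne.symm h]
  rw [← Matrix.charpoly_diagonal, ← hdiag, LinearMap.charpoly_toMatrix,
    Matrix.charpoly_toLin']

theorem empiricalSpectralMeasure_normalizedGCirculant [DecidableEq G] (y : G → ℂ) :
    empiricalSpectralMeasure (normalizedGCirculant y) =
      (Fintype.card G : ℝ≥0∞)⁻¹ •
        ∑ χ : AddChar (Additive G) ℂ, Measure.dirac (circulantEigenvalue y χ) := by
  rw [empiricalSpectralMeasure, charpoly_normalizedGCirculant, Finset.prod]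
  have h : Finset.univ.val.map (fun χ : AddChar (Additive G) ℂ =>
      Polynomial.X - Polynomial.C (circulantEigenvalue y χ)) =
      (Finset.univ.val.map (circulantEigenvalue y)).map
        fun z => Polynomial.X - Polynomial.C z := by
    rw [Multiset.map_map]
    rfl
  rw [h, Polynomial.roots_multiset_prod_X_sub_C, Multiset.map_map]
  rfl

theorem integral_empiricalSpectralMeasure_normalizedGCirculant [DecidableEq G] (y : G → ℂ)
    (f : ℂ →ᵇ ℝ) :
    ∫ z, f z ∂(empiricalSpectralMeasure (normalizedGCirculant y)) =
      (Fintype.card G : ℝ)⁻¹ * ∑ χ : AddChar (Additive G) ℂ, f (circulantEigenvalue y χ) := by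
  rw [empiricalSpectralMeasure_normalizedGCirculant, integral_smul_measure,
    integral_finsetSum_measure fun χ _ => f.integrable _]
  simp

/-- Distinct characters are orthogonal, so that `∑ a |s χ a + t ψ a|²` splits. -/
theorem sum_norm_sq_mul_add_mul {χ ψ : AddChar (Additive G) ℂ} (h : χ ≠ ψ) (s t : ℂ) :
    ∑ a : G, ‖s * χ (Additive.ofMul a) + t * ψ (Additive.ofMul a)‖ ^ 2 =
      Fintype.card G * (‖s‖ ^ 2 + ‖t‖ ^ 2) := by
  have horth : ∑ a : G, χ (Additive.ofMul a) * star (ψ (Additive.ofMul a)) = 0 := by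
    have h1 : χ * ψ⁻¹ ≠ 1 := by rwa [Ne, mul_inv_eq_one]
    rw [← AddChar.sum_eq_zero_of_ne_one h1]
    refine Fintype.sum_equiv Additive.ofMul _ _ fun a => ?_
    rw [AddChar.mul_apply, AddChar.inv_apply, AddChar.map_neg_eq_conj]
    rfl
  have hterm (a : G) : ‖s * χ (Additive.ofMul a) + t * ψ (Additive.ofMul a)‖ ^ 2 =
      ‖s‖ ^ 2 + ‖t‖ ^ 2 + 2 * (s * star t *
        (χ (Additive.ofMul a) * star (ψ (Additive.ofMul a)))).re := by
    rw [← Complex.normSq_eq_norm_sq, Complex.normSq_add, Complex.normSq_mul, Complex.normSq_mul,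
      Complex.normSq_eq_norm_sq, Complex.normSq_eq_norm_sq, Complex.normSq_eq_norm_sq,
      Complex.normSq_eq_norm_sq, AddChar.norm_apply, AddChar.norm_apply, map_mul]
    simp only [one_pow, mul_one, Complex.star_def]
    ring_nf
  have hsum : ∑ a : G, (s * star t *
      (χ (Additive.ofMul a) * star (ψ (Additive.ofMul a)))).re = 0 := by
    rw [← Complex.re_sum, ← Finset.mul_sum, horth]
    simp
  simp_rw [hterm]
  rw [Finset.sum_add_distrib, ← Finset.mul_sum, hsum]
  simp only [Finset.sum_const, Finset.card_univ, nsmul_eq_mul, mul_zero, add_zero]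

end Circulant

/-! ### The standard complex Gaussian -/

section Gaussian

theorem charFun_stdComplexGaussian (t : ℂ) :
    charFun stdComplexGaussian t = (Real.exp (-‖t‖ ^ 2 / 4) : ℝ) := by
  have hm : Measurable fun p : ℝ × ℝ => (⟨p.1, p.2⟩ : ℂ) :=
    Complex.measurableEquivRealProd.symm.measurable
  rw [charFun_apply, stdComplexGaussian, integral_map hm.aemeasurable (by fun_prop)]
  have h (p : ℝ × ℝ) : Complex.exp ((inner ℝ (⟨p.1, p.2⟩ : ℂ) t : ℝ) * Complex.I) =
      Complex.exp (t.re * p.1 * Complex.I) * Complex.exp (t.im * p.2 * Complex.I) := by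
    rw [← Complex.exp_add, Complex.inner]
    simp only [Complex.mul_re, Complex.conj_re, Complex.conj_im]
    push_cast
    ring_nf
  simp_rw [h]
  rw [integral_prod_mul (fun x : ℝ => Complex.exp (t.re * x * Complex.I))
    (fun x : ℝ => Complex.exp (t.im * x * Complex.I)), ← charFun_apply_real, ← charFun_apply_real,
    charFun_gaussianReal, charFun_gaussianReal, ← Complex.exp_add, Complex.ofReal_exp,
    ← Complex.normSq_eq_norm_sq, Complex.normSq_apply]
  push_cast
  ring_nf

instance : IsProbabilityMeasure stdComplexGaussian :=
  Measure.isProbabilityMeasure_map Complex.measurableEquivRealProd.symm.measurable.aemeasurable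

end Gaussian

/-! ### Joint law of two eigenvalues -/

section Pair

variable {G : Type*} [CommGroup G] [Fintype G] {Ω : Type*}

/-- Two eigenvalues, as a random vector in the Euclidean plane over `ℂ`. -/
noncomputable def eigenvaluePair (Y : G → Ω → ℂ)
    (p : AddChar (Additive G) ℂ × AddChar (Additive G) ℂ) (ω : Ω) : WithLp 2 (ℂ × ℂ) :=
  WithLp.toLp 2 (circulantEigenvalue (fun a => Y a ω) p.1,
    circulantEigenvalue (fun a => Y a ω) p.2)

/-- This brings the characteristic function of the pair into the scope of the one-dimensional
Lindeberg estimate. -/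
theorem inner_eigenvaluePair (Y : G → Ω → ℂ)
    (p : AddChar (Additive G) ℂ × AddChar (Additive G) ℂ) (ω : Ω) (t : WithLp 2 (ℂ × ℂ)) :
    inner ℝ (eigenvaluePair Y p ω) t =
      (∑ a, (((1 / √(Fintype.card G : ℝ) : ℝ) : ℂ) * star (t.fst * p.1 (Additive.ofMul a) +
        t.snd * p.2 (Additive.ofMul a))) * Y a ω).re := by
  have hre (w z : ℂ) : inner ℝ w z = (w * star z).re := by
    rw [Complex.inner, Complex.star_def, ← Complex.conj_re, map_mul, Complex.conj_conj, mul_comm]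
  rw [WithLp.prod_inner_apply, hre, hre, ← Complex.add_re]
  simp only [eigenvaluePair, circulantEigenvalue, Finset.sum_mul]
  rw [← Finset.sum_add_distrib]
  congr 1
  refine Finset.sum_congr rfl fun a _ => ?_
  simp only [star_add, star_mul', WithLp.ofLp_fst, WithLp.ofLp_snd]
  ring

variable [MeasurableSpace Ω]

theorem measurable_circulantEigenvalue {Y : G → Ω → ℂ} (hmeas : ∀ a, Measurable (Y a))
    (χ : AddChar (Additive G) ℂ) :
    Measurable fun ω => circulantEigenvalue (fun a => Y a ω) χ := by
  unfold circulantEigenvalue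
  fun_prop

theorem measurable_eigenvaluePair {Y : G → Ω → ℂ} (hmeas : ∀ a, Measurable (Y a))
    (p : AddChar (Additive G) ℂ × AddChar (Additive G) ℂ) : Measurable (eigenvaluePair Y p) := by
  unfold eigenvaluePair
  have h1 := measurable_circulantEigenvalue hmeas p.1
  have h2 := measurable_circulantEigenvalue hmeas p.2
  fun_prop

/-- The coefficients are at most `K / √N`, while orthogonality makes their squares sum to exactly
`‖t.fst‖² + ‖t.snd‖²`. The bound does not depend on the pair `p`, which allows averaging. -/
theorem norm_integral_exp_inner_eigenvaluePair_sub_le {P : Measure Ω} [IsProbabilityMeasure P]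
    {Y : G → Ω → ℂ} (hmeas : ∀ a, Measurable (Y a)) (hindep : iIndepFun Y P)
    (hmean : ∀ a, ∫ ω, Y a ω ∂P = 0) (hvar : ∀ a, ∫ ω, ‖Y a ω‖ ^ 2 ∂P = 1)
    (hsq : ∀ a, ∫ ω, (Y a ω) ^ 2 ∂P = 0)
    {p : AddChar (Additive G) ℂ × AddChar (Additive G) ℂ} (hp : p.1 ≠ p.2)
    (t : WithLp 2 (ℂ × ℂ)) {K δ : ℝ} (hK : 0 < K) (htK : ‖t.fst‖ + ‖t.snd‖ ≤ K)
    (hδ : 0 < δ) (hδ1 : δ ≤ 1) :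
    ‖∫ ω, Complex.exp ((inner ℝ (eigenvaluePair Y p ω) t : ℝ) * Complex.I) ∂P -
        (Real.exp (-(‖t.fst‖ ^ 2 + ‖t.snd‖ ^ 2) / 4) : ℝ)‖ ≤
      3 * δ * K ^ 2 + K ^ 4 / Fintype.card G + 4 * K ^ 2 * ((1 / (Fintype.card G : ℝ)) *
        ∑ a, ∫ ω in {ω | δ / K * √(Fintype.card G : ℝ) ≤ ‖Y a ω‖}, ‖Y a ω‖ ^ 2 ∂P) := by
  set N : ℝ := (Fintype.card G : ℝ) with hN
  have hN0 : 0 < N := Nat.cast_pos.2 Fintype.card_pos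
  have hsN : 0 < √N := Real.sqrt_pos.2 hN0
  have hNsq : √N ^ 2 = N := Real.sq_sqrt hN0.le
  set c : G → ℂ := fun a => ((1 / √N : ℝ) : ℂ) * star (t.fst * p.1 (Additive.ofMul a) +
    t.snd * p.2 (Additive.ofMul a)) with hc
  have hcn (a : G) : ‖c a‖ = 1 / √N * ‖t.fst * p.1 (Additive.ofMul a) +
      t.snd * p.2 (Additive.ofMul a)‖ := by
    rw [hc]
    simp only [norm_mul, norm_star, Complex.norm_real, Real.norm_eq_abs]
    rw [abs_of_pos (by positivity)]
  have hcK (a : G) : ‖c a‖ ≤ K / √N := by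
    rw [hcn, one_div, inv_mul_eq_div]
    gcongr
    refine (norm_add_le _ _).trans ?_
    simpa [AddChar.norm_apply] using htK
  have hcsum : ∑ a, ‖c a‖ ^ 2 = ‖t.fst‖ ^ 2 + ‖t.snd‖ ^ 2 := by
    simp_rw [hcn, mul_pow]
    rw [← Finset.mul_sum, sum_norm_sq_mul_add_mul hp, div_pow, hNsq, ← hN]
    field_simp
  have h := norm_integral_exp_sum_re_sub_exp_le hmeas hindep hmean hvar hsq hcK hδ hδ1
  rw [hcsum] at h
  simp_rw [inner_eigenvaluePair]
  refine h.trans_eq ?_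
  have hset (a : G) : {ω | δ ≤ K / √N * ‖Y a ω‖} = {ω | δ / K * √N ≤ ‖Y a ω‖} := by
    ext ω
    simp only [Set.mem_ofPred_eq]
    rw [div_mul_eq_mul_div, le_div_iff₀ hsN, div_mul_eq_mul_div, div_le_iff₀ hK, mul_comm K]
  simp_rw [hset]
  have h4 : √N ^ 4 = N ^ 2 := by rw [pow_mul (√N) 2 2, hNsq]
  rw [← hN, div_pow, div_pow, hNsq, h4]
  field_simp

/-- The mean of `μ ⊗ μ`, where `μ` is the empirical spectral measure. -/
noncomputable def eigenvaluePairMeasure (P : Measure Ω) (Y : G → Ω → ℂ) :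
    Measure (WithLp 2 (ℂ × ℂ)) :=
  ((Fintype.card G : ℝ≥0∞) ^ 2)⁻¹ • ∑ p, P.map (eigenvaluePair Y p)

theorem isProbabilityMeasure_eigenvaluePairMeasure (P : Measure Ω) [IsProbabilityMeasure P]
    {Y : G → Ω → ℂ} (hmeas : ∀ a, Measurable (Y a)) :
    IsProbabilityMeasure (eigenvaluePairMeasure P Y) := by
  refine ⟨?_⟩
  have h (p) : (P.map (eigenvaluePair Y p)) Set.univ = 1 := by
    rw [Measure.map_apply (measurable_eigenvaluePair hmeas p) MeasurableSet.univ]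
    simp
  simp only [eigenvaluePairMeasure, Measure.smul_apply, Measure.finsetSum_apply, h, smul_eq_mul,
    Finset.sum_const, Finset.card_univ, Fintype.card_prod, AddChar.card_eq, nsmul_eq_mul, mul_one]
  rw [Fintype.card_additive]
  push_cast
  rw [← sq]
  refine ENNReal.inv_mul_cancel ?_ (by finiteness)
  exact pow_ne_zero _ (by exact_mod_cast Fintype.card_ne_zero)

theorem integral_eigenvaluePairMeasure {P : Measure Ω} [IsProbabilityMeasure P]
    {Y : G → Ω → ℂ} (hmeas : ∀ a, Measurable (Y a))
    {E : Type*} [NormedAddCommGroup E] [NormedSpace ℝ E] [SecondCountableTopology E]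
    [MeasurableSpace E] [BorelSpace E]
    (f : WithLp 2 (ℂ × ℂ) →ᵇ E) :
    ∫ x, f x ∂(eigenvaluePairMeasure P Y) =
      ((Fintype.card G : ℝ) ^ 2)⁻¹ • ∑ p, ∫ ω, f (eigenvaluePair Y p ω) ∂P := by
  have hprob (p) : IsProbabilityMeasure (P.map (eigenvaluePair Y p)) :=
    Measure.isProbabilityMeasure_map (measurable_eigenvaluePair hmeas p).aemeasurable
  rw [eigenvaluePairMeasure, integral_smul_measure,
    integral_finsetSum_measure fun p _ => f.integrable _]
  congr 1
  · simp
  · exact Finset.sum_congr rfl fun p _ => integral_map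
      (measurable_eigenvaluePair hmeas p).aemeasurable f.continuous.aestronglyMeasurable

theorem norm_charFun_eigenvaluePairMeasure_sub_le {P : Measure Ω} [IsProbabilityMeasure P]
    {Y : G → Ω → ℂ} (hmeas : ∀ a, Measurable (Y a)) (hindep : iIndepFun Y P)
    (hmean : ∀ a, ∫ ω, Y a ω ∂P = 0) (hvar : ∀ a, ∫ ω, ‖Y a ω‖ ^ 2 ∂P = 1)
    (hsq : ∀ a, ∫ ω, (Y a ω) ^ 2 ∂P = 0)
    (t : WithLp 2 (ℂ × ℂ)) {K δ : ℝ} (hK : 0 < K) (htK : ‖t.fst‖ + ‖t.snd‖ ≤ K)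
    (hδ : 0 < δ) (hδ1 : δ ≤ 1) :
    ‖charFun (eigenvaluePairMeasure P Y) t -
        (Real.exp (-(‖t.fst‖ ^ 2 + ‖t.snd‖ ^ 2) / 4) : ℝ)‖ ≤
      2 / Fintype.card G +
      (3 * δ * K ^ 2 + K ^ 4 / Fintype.card G + 4 * K ^ 2 * ((1 / (Fintype.card G : ℝ)) *
        ∑ a, ∫ ω in {ω | δ / K * √(Fintype.card G : ℝ) ≤ ‖Y a ω‖}, ‖Y a ω‖ ^ 2 ∂P)) := by
  classical
  set B := 3 * δ * K ^ 2 + K ^ 4 / Fintype.card G + 4 * K ^ 2 * ((1 / (Fintype.card G : ℝ)) *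
        ∑ a, ∫ ω in {ω | δ / K * √(Fintype.card G : ℝ) ≤ ‖Y a ω‖}, ‖Y a ω‖ ^ 2 ∂P) with hB
  set g : ℂ := ((Real.exp (-(‖t.fst‖ ^ 2 + ‖t.snd‖ ^ 2) / 4) : ℝ) : ℂ) with hg
  have hB0 : 0 ≤ B := by
    have : ∀ a, 0 ≤ ∫ ω in {ω | δ / K * √(Fintype.card G : ℝ) ≤ ‖Y a ω‖}, ‖Y a ω‖ ^ 2 ∂P :=
      fun a => integral_nonneg fun ω => by positivity
    have := Finset.sum_nonneg fun a (_ : a ∈ Finset.univ) => this a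
    positivity
  have hg1 : ‖g‖ ≤ 1 := by
    rw [hg, Complex.norm_real, Real.norm_eq_abs, Real.abs_exp, Real.exp_le_one_iff, neg_div,
      neg_nonpos]
    positivity
  have hN0 : (0 : ℝ) < Fintype.card G := by exact_mod_cast Fintype.card_pos (α := G)
  have hcard : (Fintype.card (AddChar (Additive G) ℂ) : ℝ) = Fintype.card G := by
    rw [AddChar.card_eq, Fintype.card_additive]
  set h : AddChar (Additive G) ℂ × AddChar (Additive G) ℂ → ℂ := fun p =>
    ∫ ω, Complex.exp ((inner ℝ (eigenvaluePair Y p ω) t : ℝ) * Complex.I) ∂P with hh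
  have hchar : charFun (eigenvaluePairMeasure P Y) t =
      ((Fintype.card G : ℝ) ^ 2)⁻¹ • ∑ p, h p := by
    rw [charFun_eq_integral_innerProbChar, integral_eigenvaluePairMeasure hmeas]
    simp_rw [BoundedContinuousFunction.innerProbChar_apply]
    rfl
  have hgsum : g = ((Fintype.card G : ℝ) ^ 2)⁻¹ •
      ∑ _p : AddChar (Additive G) ℂ × AddChar (Additive G) ℂ, g := by
    rw [Finset.sum_const, Finset.card_univ, Fintype.card_prod, ← Nat.cast_smul_eq_nsmul ℝ,
      smul_smul, Nat.cast_mul, hcard, ← sq, inv_mul_cancel₀ (by positivity), one_smul]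
  -- On the diagonal the trivial bound 2 suffices; after averaging it contributes `2N / N² = 2 / N`.
  have hpair (p) : ‖h p - g‖ ≤ B + if p.1 = p.2 then 2 else 0 := by
    split_ifs with hp
    · have h1 : ‖h p‖ ≤ 1 := (norm_integral_le_of_norm_le_const (C := 1) (by
        simp only [Complex.norm_exp_ofReal_mul_I]; simp)).trans (by simp)
      linarith [norm_sub_le (h p) g]
    · rw [add_zero]
      exact norm_integral_exp_inner_eigenvaluePair_sub_le hmeas hindep hmean hvar hsq hp t hK htK
        hδ hδ1
  rw [hchar, hgsum, ← smul_sub, ← Finset.sum_sub_distrib, norm_smul, norm_inv, norm_pow,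
    Real.norm_natCast]
  calc ((Fintype.card G : ℝ) ^ 2)⁻¹ * ‖∑ p, (h p - g)‖
      ≤ ((Fintype.card G : ℝ) ^ 2)⁻¹ *
        ∑ p : AddChar (Additive G) ℂ × AddChar (Additive G) ℂ,
          (B + if p.1 = p.2 then 2 else 0) := by
        gcongr
        exact norm_sum_le_of_le _ fun p _ => hpair p
    _ = 2 / Fintype.card G + B := by
        rw [Finset.sum_add_distrib, Fintype.sum_prod_type, Fintype.sum_prod_type]
        simp only [Finset.sum_const, Finset.card_univ, nsmul_eq_mul, hcard, Finset.sum_ite_eq,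
          Finset.mem_univ, if_true]
        field_simp
        ring

end Pair

theorem charFun_prod_stdComplexGaussian (t : WithLp 2 (ℂ × ℂ)) :
    charFun ((stdComplexGaussian.prod stdComplexGaussian).map (WithLp.toLp 2)) t =
      (Real.exp (-(‖t.fst‖ ^ 2 + ‖t.snd‖ ^ 2) / 4) : ℝ) := by
  rw [charFun_prod, charFun_stdComplexGaussian, charFun_stdComplexGaussian, ← Complex.ofReal_mul,
    ← Real.exp_add]
  rw [WithLp.ofLp_fst, WithLp.ofLp_snd]
  congr 2
  ring

/-! ### Weak convergence of the mean of `μ ⊗ μ` -/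

section Sequence

variable {G : ℕ → Type*} [∀ n, CommGroup (G n)] [∀ n, Fintype (G n)]
  {Ω : ℕ → Type*} [∀ n, MeasurableSpace (Ω n)]

theorem tendsto_charFun_eigenvaluePairMeasure
    (hG : Tendsto (fun n => Fintype.card (G n)) atTop atTop)
    (P : ∀ n, Measure (Ω n)) [∀ n, IsProbabilityMeasure (P n)]
    (Y : ∀ n, G n → Ω n → ℂ)
    (hmeas : ∀ n a, Measurable (Y n a))
    (hindep : ∀ n, iIndepFun (Y n) (P n))
    (hmean : ∀ n a, ∫ ω, Y n a ω ∂(P n) = 0)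
    (hvar : ∀ n a, ∫ ω, ‖Y n a ω‖ ^ 2 ∂(P n) = 1)
    (hsq : ∀ n a, ∫ ω, (Y n a ω) ^ 2 ∂(P n) = 0)
    (hlind : LindebergCondition P Y) (t : WithLp 2 (ℂ × ℂ)) :
    Tendsto (fun n => charFun (eigenvaluePairMeasure (P n) (Y n)) t) atTop
      (𝓝 (Real.exp (-(‖t.fst‖ ^ 2 + ‖t.snd‖ ^ 2) / 4) : ℝ)) := by
  -- The summand 1 keeps `K` positive when `t = 0`.
  set K := ‖t.fst‖ + ‖t.snd‖ + 1 with hKdef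
  have hK : 0 < K := by positivity
  have hinv : Tendsto (fun n => (Fintype.card (G n) : ℝ)⁻¹) atTop (𝓝 0) :=
    tendsto_inv_atTop_zero.comp (tendsto_natCast_atTop_atTop.comp hG)
  rw [Metric.tendsto_nhds]
  intro η hη
  -- The term `3δK²` does not vanish as `n → ∞`, so `δ` is fixed first to make it at most `η/2`; the
  -- Lindeberg condition is then used at level `δ / K`.
  set δ := min 1 (η / (6 * K ^ 2)) with hδdef
  have hδ : 0 < δ := by positivity
  have hδη : 3 * δ * K ^ 2 ≤ η / 2 := by
    have : δ ≤ η / (6 * K ^ 2) := min_le_right _ _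
    rw [le_div_iff₀ (by positivity)] at this
    linarith
  have hlim : Tendsto (fun n => 2 / (Fintype.card (G n) : ℝ) +
      (K ^ 4 / Fintype.card (G n) + 4 * K ^ 2 * ((1 / (Fintype.card (G n) : ℝ)) *
        ∑ a, ∫ ω in {ω | δ / K * √(Fintype.card (G n) : ℝ) ≤ ‖Y n a ω‖}, ‖Y n a ω‖ ^ 2 ∂(P n))))
      atTop (𝓝 0) := by
    have := (hinv.const_mul 2).add ((hinv.const_mul (K ^ 4)).add
      ((hlind (δ / K) (by positivity)).const_mul (4 * K ^ 2)))
    simpa only [mul_zero, add_zero, ← div_eq_mul_inv] using this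
  filter_upwards [hlim.eventually (gt_mem_nhds (half_pos hη))] with n hn
  rw [dist_eq_norm]
  refine (norm_charFun_eigenvaluePairMeasure_sub_le (hmeas n) (hindep n) (hmean n) (hvar n) (hsq n)
    t hK (by linarith) hδ (min_le_left _ _)).trans_lt ?_
  linarith

/-- The mean of `μ ⊗ μ` converges weakly to the law of two independent standard complex
Gaussians. -/
theorem tendsto_integral_eigenvaluePairMeasure
    (hG : Tendsto (fun n => Fintype.card (G n)) atTop atTop)
    (P : ∀ n, Measure (Ω n)) [∀ n, IsProbabilityMeasure (P n)]
    (Y : ∀ n, G n → Ω n → ℂ)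
    (hmeas : ∀ n a, Measurable (Y n a))
    (hindep : ∀ n, iIndepFun (Y n) (P n))
    (hmean : ∀ n a, ∫ ω, Y n a ω ∂(P n) = 0)
    (hvar : ∀ n a, ∫ ω, ‖Y n a ω‖ ^ 2 ∂(P n) = 1)
    (hsq : ∀ n a, ∫ ω, (Y n a ω) ^ 2 ∂(P n) = 0)
    (hlind : LindebergCondition P Y) (f g : ℂ →ᵇ ℝ) :
    Tendsto (fun n => ((Fintype.card (G n) : ℝ) ^ 2)⁻¹ * ∑ p, ∫ ω,
        f (eigenvaluePair (Y n) p ω).fst * g (eigenvaluePair (Y n) p ω).snd ∂(P n)) atTop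
      (𝓝 ((∫ z, f z ∂stdComplexGaussian) * ∫ z, g z ∂stdComplexGaussian)) := by
  have hmap : Measurable (WithLp.toLp 2 : ℂ × ℂ → WithLp 2 (ℂ × ℂ)) := by fun_prop
  let ν (n : ℕ) : ProbabilityMeasure (WithLp 2 (ℂ × ℂ)) :=
    ⟨eigenvaluePairMeasure (P n) (Y n), isProbabilityMeasure_eigenvaluePairMeasure _ (hmeas n)⟩
  let ν₀ : ProbabilityMeasure (WithLp 2 (ℂ × ℂ)) :=
    ⟨(stdComplexGaussian.prod stdComplexGaussian).map (WithLp.toLp 2),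
      Measure.isProbabilityMeasure_map hmap.aemeasurable⟩
  have hν : Tendsto ν atTop (𝓝 ν₀) := by
    -- Lévy's continuity theorem.
    refine ProbabilityMeasure.tendsto_of_tendsto_charFun fun t => ?_
    change Tendsto _ _ (𝓝 (charFun ((stdComplexGaussian.prod stdComplexGaussian).map
      (WithLp.toLp 2)) t))
    rw [charFun_prod_stdComplexGaussian]
    exact tendsto_charFun_eigenvaluePairMeasure hG P Y hmeas hindep hmean hvar hsq hlind t
  let F : WithLp 2 (ℂ × ℂ) →ᵇ ℝ :=
    f.compContinuous ⟨fun x => x.fst, by fun_prop⟩ * g.compContinuous ⟨fun x => x.snd, by fun_prop⟩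
  have hF := (ProbabilityMeasure.tendsto_iff_forall_integral_tendsto.1 hν) F
  have hlim : ∫ x, F x ∂(ν₀ : Measure (WithLp 2 (ℂ × ℂ))) =
      (∫ z, f z ∂stdComplexGaussian) * ∫ z, g z ∂stdComplexGaussian := by
    rw [← integral_prod_mul]
    exact integral_map hmap.aemeasurable F.continuous.aestronglyMeasurable
  rw [hlim] at hF
  refine hF.congr fun n => ?_
  exact integral_eigenvaluePairMeasure (hmeas n) F

end Sequence

/-! ### Moments of the empirical spectral measure -/

section Spectral

variable {G : Type*} [CommGroup G] [Fintype G] {Ω : Type*} [MeasurableSpace Ω]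

theorem integrable_comp_circulantEigenvalue {P : Measure Ω} [IsProbabilityMeasure P]
    {Y : G → Ω → ℂ} (hmeas : ∀ a, Measurable (Y a)) (f : ℂ →ᵇ ℝ)
    (χ : AddChar (Additive G) ℂ) :
    Integrable (fun ω => f (circulantEigenvalue (fun a => Y a ω) χ)) P :=
  Integrable.of_bound (C := ‖f‖)
    (f.continuous.measurable.comp (measurable_circulantEigenvalue hmeas χ)).aestronglyMeasurable
    (by filter_upwards with ω using f.norm_coe_le_norm _)

variable [DecidableEq G]

theorem integrable_integral_empiricalSpectralMeasure {P : Measure Ω} [IsProbabilityMeasure P]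
    {Y : G → Ω → ℂ} (hmeas : ∀ a, Measurable (Y a)) (f : ℂ →ᵇ ℝ) :
    Integrable (fun ω => ∫ z, f z ∂(empiricalSpectralMeasure
      (normalizedGCirculant fun a => Y a ω))) P := by
  simp_rw [integral_empiricalSpectralMeasure_normalizedGCirculant]
  exact (integrable_finsetSum _ fun χ _ => integrable_comp_circulantEigenvalue hmeas f χ).const_mul _

theorem integrable_mul_integral_empiricalSpectralMeasure {P : Measure Ω} [IsProbabilityMeasure P]
    {Y : G → Ω → ℂ} (hmeas : ∀ a, Measurable (Y a)) (f g : ℂ →ᵇ ℝ) :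
    Integrable (fun ω =>
      (∫ z, f z ∂(empiricalSpectralMeasure (normalizedGCirculant fun a => Y a ω))) *
        ∫ z, g z ∂(empiricalSpectralMeasure (normalizedGCirculant fun a => Y a ω))) P := by
  refine (integrable_integral_empiricalSpectralMeasure hmeas f).mul_bdd (c := ‖g‖)
    (integrable_integral_empiricalSpectralMeasure hmeas g).aestronglyMeasurable ?_
  filter_upwards with ω
  rw [integral_empiricalSpectralMeasure_normalizedGCirculant, norm_mul, norm_inv,
    Real.norm_natCast, inv_mul_le_iff₀ (Nat.cast_pos.2 Fintype.card_pos)]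
  refine (norm_sum_le_of_le _ fun χ _ => g.norm_coe_le_norm _).trans_eq ?_
  simp

theorem integral_mul_integral_empiricalSpectralMeasure {P : Measure Ω} [IsProbabilityMeasure P]
    {Y : G → Ω → ℂ} (hmeas : ∀ a, Measurable (Y a)) (f g : ℂ →ᵇ ℝ) :
    ∫ ω, (∫ z, f z ∂(empiricalSpectralMeasure (normalizedGCirculant fun a => Y a ω))) *
        ∫ z, g z ∂(empiricalSpectralMeasure (normalizedGCirculant fun a => Y a ω)) ∂P =
      ((Fintype.card G : ℝ) ^ 2)⁻¹ * ∑ p, ∫ ω,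
        f (eigenvaluePair Y p ω).fst * g (eigenvaluePair Y p ω).snd ∂P := by
  have hint (p : AddChar (Additive G) ℂ × AddChar (Additive G) ℂ) :
      Integrable (fun ω => f (eigenvaluePair Y p ω).fst * g (eigenvaluePair Y p ω).snd) P :=
    (integrable_comp_circulantEigenvalue hmeas f p.1).mul_bdd (c := ‖g‖)
      (integrable_comp_circulantEigenvalue hmeas g p.2).aestronglyMeasurable
      (by filter_upwards with ω using g.norm_coe_le_norm _)
  rw [← integral_finsetSum _ fun p _ => hint p, ← integral_const_mul]
  congr 1
  ext ω
  rw [integral_empiricalSpectralMeasure_normalizedGCirculant,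
    integral_empiricalSpectralMeasure_normalizedGCirculant, mul_mul_mul_comm,
    Fintype.sum_mul_sum, ← Fintype.sum_prod_type', ← mul_inv, ← sq]
  rfl

end Spectral

/-- Random variables whose first two moments converge to those of a constant converge to it in
probability. -/
theorem tendsto_measure_le_abs_sub_of_moments {Ω : ℕ → Type*} [∀ n, MeasurableSpace (Ω n)]
    (P : ∀ n, Measure (Ω n)) [∀ n, IsProbabilityMeasure (P n)] {X : ∀ n, Ω n → ℝ} {m : ℝ}
    (hX : ∀ n, Integrable (X n) (P n)) (hX2 : ∀ n, Integrable (fun ω => X n ω * X n ω) (P n))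
    (h1 : Tendsto (fun n => ∫ ω, X n ω ∂(P n)) atTop (𝓝 m))
    (h2 : Tendsto (fun n => ∫ ω, X n ω * X n ω ∂(P n)) atTop (𝓝 (m * m)))
    {ε : ℝ} (hε : 0 < ε) :
    Tendsto (fun n => P n {ω | ε ≤ |X n ω - m|}) atTop (𝓝 0) := by
  have hexpand (n : ℕ) (ω : Ω n) :
      (X n ω - m) ^ 2 = X n ω * X n ω - 2 * m * X n ω + m ^ 2 := by ring
  have hint (n : ℕ) : Integrable (fun ω => X n ω * X n ω - 2 * m * X n ω) (P n) :=
    (hX2 n).sub ((hX n).const_mul _)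
  have hint' (n : ℕ) : Integrable (fun ω => (X n ω - m) ^ 2) (P n) := by
    simp_rw [hexpand]
    exact (hint n).add (integrable_const _)
  have hvar : Tendsto (fun n => ∫ ω, (X n ω - m) ^ 2 ∂(P n)) atTop (𝓝 0) := by
    have heq (n : ℕ) : ∫ ω, (X n ω - m) ^ 2 ∂(P n) =
        ∫ ω, X n ω * X n ω ∂(P n) - 2 * m * ∫ ω, X n ω ∂(P n) + m ^ 2 := by
      simp_rw [hexpand]
      rw [integral_add (hint n) (integrable_const _),
        integral_sub (hX2 n) ((hX n).const_mul _), integral_const_mul]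
      simp
    simp_rw [heq]
    convert! (h2.sub (h1.const_mul (2 * m))).add_const (m ^ 2) using 2
    ring
  -- Chebyshev's inequality, centred at the limit `m` rather than at the mean of `X n`.
  have hreal : Tendsto (fun n => (P n).real {ω | ε ≤ |X n ω - m|}) atTop (𝓝 0) := by
    refine squeeze_zero (fun n => measureReal_nonneg) (fun n => ?_)
      (by simpa using hvar.const_mul (ε ^ 2)⁻¹)
    rw [inv_mul_eq_div, le_div_iff₀ (by positivity), mul_comm]
    have hset : {ω | ε ≤ |X n ω - m|} = {ω | ε ^ 2 ≤ (X n ω - m) ^ 2} := by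
      ext ω
      simp only [Set.mem_ofPred_eq]
      rw [← sq_abs (X n ω - m), sq_le_sq₀ hε.le (abs_nonneg _)]
    rw [hset]
    exact mul_meas_ge_le_integral_of_nonneg (ae_of_all _ fun ω => sq_nonneg _) (hint' n) _
  have := (ENNReal.continuous_ofReal.tendsto 0).comp hreal
  simpa [Function.comp_def, ofReal_measureReal] using this

theorem theoremT
    {G : ℕ → Type*} [∀ n, CommGroup (G n)] [∀ n, Fintype (G n)] [∀ n, DecidableEq (G n)]
    (hG : Tendsto (fun n => Fintype.card (G n)) atTop atTop)
    {Ω : ℕ → Type*} [∀ n, MeasurableSpace (Ω n)]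
    (P : ∀ n, Measure (Ω n)) [∀ n, IsProbabilityMeasure (P n)]
    (Y : ∀ n, G n → Ω n → ℂ)
    (hmeas : ∀ n a, Measurable (Y n a))
    (hindep : ∀ n, iIndepFun (Y n) (P n))
    (hmean : ∀ n a, ∫ ω, Y n a ω ∂(P n) = 0)
    (hvar : ∀ n a, ∫ ω, ‖Y n a ω‖ ^ 2 ∂(P n) = 1)
    (hsq : ∀ n a, ∫ ω, (Y n a ω) ^ 2 ∂(P n) = 0)
    (hlind : LindebergCondition P Y) :
    ConvergesWeaklyInMean P
        (fun n ω => empiricalSpectralMeasure (normalizedGCirculant fun a => Y n a ω))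
        stdComplexGaussian ∧
      ConvergesWeaklyInProbability P
        (fun n ω => empiricalSpectralMeasure (normalizedGCirculant fun a => Y n a ω))
        stdComplexGaussian := by
  have hpair (f g : ℂ →ᵇ ℝ) := by
    have := tendsto_integral_eigenvaluePairMeasure hG P Y hmeas hindep hmean hvar hsq hlind f g
    simp_rw [← fun n => integral_mul_integral_empiricalSpectralMeasure (P := P n) (hmeas n) f g]
      at this
    exact this
  have hone (n : ℕ) (ω : Ω n) : ∫ z, (1 : ℂ →ᵇ ℝ) z
      ∂(empiricalSpectralMeasure (normalizedGCirculant fun a => Y n a ω)) = 1 := by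
    rw [integral_empiricalSpectralMeasure_normalizedGCirculant]
    simp
  have hmeanConv (f : ℂ →ᵇ ℝ) := by
    -- The spectral measure has mass 1, so the constant test function reduces the mixed moment to
    -- the first moment.
    have := hpair f 1
    simp only [hone] at this
    simpa using this
  exact ⟨fun f => ⟨fun n => integrable_integral_empiricalSpectralMeasure (hmeas n) f,
      hmeanConv f⟩,
    fun f ε hε => tendsto_measure_le_abs_sub_of_moments P
      (fun n => integrable_integral_empiricalSpectralMeasure (hmeas n) f)
      (fun n => integrable_mul_integral_empiricalSpectralMeasure (hmeas n) f f)
      (hmeanConv f) (hpair f f) hε⟩
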